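/- Let $Q$ be a smooth finite-dimensional manifold without boundary (Hausdorff, second countable) and let $t:Q\to\mathbb R$ be a smooth, locally trivial fibre bundle with typical fibre a smooth manifold $M$; $(t,q^i)$ denote bundle coordinates. For a smooth curve $c$ in $Q$ let $\dot c$ and $\ddot c$ be its prolongations to $TQ$ and $TTQ$. The jet manifolds $J^1Q$ and $J^2Q$ of sections of $Q\to\mathbb R$ are identified with their images in $TQ$ and $TTQ$ under the canonical imbeddings $\lambda: j^1_t s\mapsto\dot s(t)$ and $T\lambda\circ\lambda_2: j^2_t s\mapsto\ddot s(t)$, that is, $$\lambda:(t,q^i,q^i_t)\mapsto(t,q^i,\dot t=1,\dot q^i=q^i_t),\qquad T\lambda\circ\lambda_2:(t,q^i,q^i_t,q^i_{tt})\mapsto(t,q^i,\dot t=\overset{\circ}{t}=1,\dot q^i=\overset{\circ}{q}{}^i=q^i_t,\ddot t=0,\ddot q^i=q^i_{tt}).$$ A dynamic equation on $Q\to\mathbb R$ is the image $\xi(J^1Q)\subset J^2Q$ of a holonomic connection $\xi$ on $J^1Q\to\mathbb R$, i.e. of a smooth section $\xi=\partial_t+q^i_t\partial_i+\xi^i\partial^t_i$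 of $J^2Q\to J^1Q$; its solutions (motions) are the smooth local sections $c$ of $Q\to\mathbb R$, defined on open intervals, whose second order jet prolongation lives in $\xi(J^1Q)$. A second order equation on the manifold $Q$ is the image $\Xi(TQ)\subset TTQ$ of a holonomic vector field $\Xi$ on $TQ$, i.e. a smooth vector field on $TQ$ with $T\pi_Q(\Xi(v))=v$ for all $v\in TQ$, where $\pi_Q:TQ\to Q$. **Proposition 3.1.** Every dynamic equation on $Q\to\mathbb R$ is equivalent to a second order equation on the manifold $Q$. Precisely, for every holonomic connection $\xi$ on $J^1Q\to\mathbb R$ there is a holonomic vector field $\Xi$ on $TQ$ such that: 1. the component $\Xi^0$ of $\Xi$ (its value on the differential of the function $\dot t$ on $TQ$) vanishes on all of $TQ$; 2. $\Xi$ extends the section $T\lambda\circ\lambda_2\circ\xi$ from $J^1Q\subset TQ$ to $TQ$: $\Xi\circ\lambda=T\lambda\circ\lambda_2\circ\xi$, i.e. $\xi^i=\Xi^i(t,q^j,\dot t=1,\dot q^j=q^j_t)$; 3. as a subset of $TTQ$, the dynamic equation $\xi(J^1Q)$ is the part of $\Xi(TQ)$ given by $$\ddot t=0,\qquad \dot t=1,\qquad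 \ddot q^i=\Xi^i;\qquad(*)$$ 4. the two equations have the same solutions: a curve $c:J\to Q$ on an open interval $J$ is a motion of $\xi$ if and only if it is a smooth solution of $(*)$ (that is, $\ddot c$ lives in the subset $(*)$) with $t(c(s))=s$ on $J$; and every smooth solution $c:J\to Q$ of $(*)$ becomes a motion of $\xi$ after a translation $s\mapsto s+a$ of its parameter by some constant $a\in\mathbb R$. -/

import Mathlib

open scoped Manifold ContDiff

noncomputable section

namespace TimeMechanics

section Bundle

variable {E : Type*} [NormedAddCommGroup E] [NormedSpace ℝ E]
  {Q : Type*} [TopologicalSpace Q] [ChartedSpace E Q]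

/-- `τ : Q → ℝ` is a smooth (locally trivial) fibre bundle over the time axis with typical
fibre `M`: it is smooth, and every instant has an open neighbourhood `U` over which there is a
fibre preserving diffeomorphism of `τ ⁻¹ U` onto `U × M`. -/
structure IsFibreBundle (F : Type*) [NormedAddCommGroup F] [NormedSpace ℝ F]
    (M : Type*) [TopologicalSpace M] [ChartedSpace F M] (τ : Q → ℝ) : Prop where
  smooth : ContMDiff 𝓘(ℝ, E) 𝓘(ℝ, ℝ) ∞ τ
  locallyTrivial : ∀ t : ℝ, ∃ U : Set ℝ, IsOpen U ∧ t ∈ U ∧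
    ∃ ψ : OpenPartialHomeomorph Q (ℝ × M),
      ψ.source = τ ⁻¹' U ∧ ψ.target = U ×ˢ Set.univ ∧
      (∀ q ∈ ψ.source, (ψ q).1 = τ q) ∧
      ContMDiffOn 𝓘(ℝ, E) (𝓘(ℝ, ℝ).prod 𝓘(ℝ, F)) ∞ ψ ψ.source ∧
      ContMDiffOn (𝓘(ℝ, ℝ).prod 𝓘(ℝ, F)) 𝓘(ℝ, E) ∞ ψ.symm ψ.target

/-- The smooth map `s`, considered near the instant `t`, is a local section of `τ`. -/
def IsLocalSectionAt (τ : Q → ℝ) (s : ℝ → Q) (t : ℝ) : Prop :=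
  ∃ U : Set ℝ, IsOpen U ∧ t ∈ U ∧ ContMDiffOn 𝓘(ℝ, ℝ) 𝓘(ℝ, E) ∞ s U ∧ ∀ r ∈ U, τ (s r) = r

/-- The tangent prolongation `ċ` of a curve `c`, with values in `TQ`. -/
def velocity (c : ℝ → Q) (t : ℝ) : TangentBundle 𝓘(ℝ, E) Q :=
  ⟨c t, mfderiv 𝓘(ℝ, ℝ) 𝓘(ℝ, E) c t (1 : ℝ)⟩

/-- The function `ṫ` on `TQ`: the value of `dt` (pulled back to `Q`) on a tangent vector. -/
def tDot (τ : Q → ℝ) (v : TangentBundle 𝓘(ℝ, E) Q) : ℝ :=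
  mfderiv 𝓘(ℝ, E) 𝓘(ℝ, ℝ) τ v.proj v.2

/-- The first order jet manifold `J¹Q` of sections of `τ`, identified with its image in `TQ`
under the canonical imbedding `λ`, which sends the jet of a section `s` at `t` to `ṡ(t)`.
Two sections have the same first order jet at `t` exactly when these images coincide. -/
def jetOne (τ : Q → ℝ) : Set (TangentBundle 𝓘(ℝ, E) Q) :=
  {v | ∃ (t : ℝ) (s : ℝ → Q), IsLocalSectionAt (E := E) τ s t ∧ velocity (E := E) s t = v}

variable [IsManifold 𝓘(ℝ, E) ∞ Q]

/-- The second order tangent prolongation `c̈` of a curve `c`: the velocity of the curve `ċ`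
in `TQ`, an element of `TTQ`. -/
def acceleration (c : ℝ → Q) (t : ℝ) :
    TangentBundle 𝓘(ℝ, E).tangent (TangentBundle 𝓘(ℝ, E) Q) :=
  ⟨velocity (E := E) c t,
    mfderiv 𝓘(ℝ, ℝ) 𝓘(ℝ, E).tangent (velocity (E := E) c) t (1 : ℝ)⟩

/-- The function `ẗ` on `TTQ`: the derivative of the function `ṫ` along an element of `TTQ`. -/
def tDDot (τ : Q → ℝ) (w : TangentBundle 𝓘(ℝ, E).tangent (TangentBundle 𝓘(ℝ, E) Q)) : ℝ :=
  mfderiv 𝓘(ℝ, E).tangent 𝓘(ℝ, ℝ) (tDot (E := E) τ) w.proj w.2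

/-- The second order jet manifold `J²Q` of sections of `τ`, identified with its image in `TTQ`
under the canonical imbedding `Tλ ∘ λ₂`, which sends the second order jet of a section `s` at `t`
to `s̈(t)`.  Two sections have the same second order jet at `t` exactly when these images
coincide. -/
def jetTwo (τ : Q → ℝ) : Set (TangentBundle 𝓘(ℝ, E).tangent (TangentBundle 𝓘(ℝ, E) Q)) :=
  {w | ∃ (t : ℝ) (s : ℝ → Q), IsLocalSectionAt (E := E) τ s t ∧ acceleration (E := E) s t = w}

/-- A field `ξ` of tangent vectors of `TQ` at the points of the submanifold `J¹Q` is a holonomic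
connection on `J¹Q → ℝ`: it is smooth on `J¹Q` and takes its values in `J²Q`.  (Elements of `J²Q`
over `v` are tangent to `J¹Q` and project to `∂_t`, so that `ξ` is a vector field on `J¹Q` with
`ξ ⌋ dt = 1`.)  Only the values of `ξ` at the points of `J¹Q` matter.  The composition
`Tλ ∘ λ₂ ∘ ξ` is `ξ` itself, under the identifications made. -/
structure IsHolonomicConnection (τ : Q → ℝ)
    (ξ : ∀ v : TangentBundle 𝓘(ℝ, E) Q, TangentSpace 𝓘(ℝ, E).tangent v) : Prop where
  smooth : ContMDiffOn 𝓘(ℝ, E).tangent 𝓘(ℝ, E).tangent.tangent ∞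
    (fun v => (⟨v, ξ v⟩ : TangentBundle 𝓘(ℝ, E).tangent (TangentBundle 𝓘(ℝ, E) Q)))
    (jetOne (E := E) τ)
  holonomic : ∀ v ∈ jetOne (E := E) τ,
    (⟨v, ξ v⟩ : TangentBundle 𝓘(ℝ, E).tangent (TangentBundle 𝓘(ℝ, E) Q)) ∈ jetTwo (E := E) τ

/-- The dynamic equation given by a holonomic connection `ξ`: the image `ξ(J¹Q) ⊂ J²Q`. -/
def dynamicEquation (τ : Q → ℝ)
    (ξ : ∀ v : TangentBundle 𝓘(ℝ, E) Q, TangentSpace 𝓘(ℝ, E).tangent v) :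
    Set (TangentBundle 𝓘(ℝ, E).tangent (TangentBundle 𝓘(ℝ, E) Q)) :=
  (fun v => (⟨v, ξ v⟩ : TangentBundle 𝓘(ℝ, E).tangent (TangentBundle 𝓘(ℝ, E) Q))) ''
    jetOne (E := E) τ

/-- A holonomic vector field on `TQ`: a smooth vector field `Ξ` on `TQ` which the tangent map
of the projection `TQ → Q` takes to `v` at each point `v`. -/
structure IsHolonomicField
    (Ξ : ∀ v : TangentBundle 𝓘(ℝ, E) Q, TangentSpace 𝓘(ℝ, E).tangent v) : Prop where
  smooth : ContMDiff 𝓘(ℝ, E).tangent 𝓘(ℝ, E).tangent.tangent ∞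
    (fun v => (⟨v, Ξ v⟩ : TangentBundle 𝓘(ℝ, E).tangent (TangentBundle 𝓘(ℝ, E) Q)))
  holonomic : ∀ v : TangentBundle 𝓘(ℝ, E) Q,
    mfderiv 𝓘(ℝ, E).tangent 𝓘(ℝ, E)
      (fun u : TangentBundle 𝓘(ℝ, E) Q => u.proj) v (Ξ v) = v.2

/-- The second order equation on the manifold `Q` given by `Ξ`: the image `Ξ(TQ) ⊂ TTQ`. -/
def secondOrderEquation
    (Ξ : ∀ v : TangentBundle 𝓘(ℝ, E) Q, TangentSpace 𝓘(ℝ, E).tangent v) :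
    Set (TangentBundle 𝓘(ℝ, E).tangent (TangentBundle 𝓘(ℝ, E) Q)) :=
  Set.range
    (fun v => (⟨v, Ξ v⟩ : TangentBundle 𝓘(ℝ, E).tangent (TangentBundle 𝓘(ℝ, E) Q)))

/-- The equation `ẗ = 0`, `ṫ = 1`, `q̈ⁱ = Ξⁱ`: the part of the second order equation `Ξ(TQ)` cut
out by the conditions `ẗ = 0` and `ṫ = 1`. -/
def unitTimeEquation (τ : Q → ℝ)
    (Ξ : ∀ v : TangentBundle 𝓘(ℝ, E) Q, TangentSpace 𝓘(ℝ, E).tangent v) :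
    Set (TangentBundle 𝓘(ℝ, E).tangent (TangentBundle 𝓘(ℝ, E) Q)) :=
  {w | w ∈ secondOrderEquation (E := E) Ξ ∧ tDDot (E := E) τ w = 0 ∧ tDot (E := E) τ w.proj = 1}

/-- The smooth curve `c : J → Q` is a solution of the second order equation `S ⊂ TTQ`: its second
order tangent prolongation lives in `S`. -/
def IsSolution (S : Set (TangentBundle 𝓘(ℝ, E).tangent (TangentBundle 𝓘(ℝ, E) Q)))
    (J : Set ℝ) (c : ℝ → Q) : Prop :=
  ContMDiffOn 𝓘(ℝ, ℝ) 𝓘(ℝ, E) ∞ c J ∧ ∀ s ∈ J, acceleration (E := E) c s ∈ S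

/-- The curve `c : J → Q` is a motion, i.e. a solution of the dynamic equation of `ξ`: it is a
local section of `Q → ℝ`, and its second order jet prolongation lives in the image of `ξ`. -/
def IsMotion (τ : Q → ℝ)
    (ξ : ∀ v : TangentBundle 𝓘(ℝ, E) Q, TangentSpace 𝓘(ℝ, E).tangent v)
    (J : Set ℝ) (c : ℝ → Q) : Prop :=
  (∀ s ∈ J, τ (c s) = s) ∧ IsSolution (dynamicEquation (E := E) τ ξ) J c

end Bundle

end TimeMechanics

end

/-! Inside `TQ` the jet manifold `J¹Q` is the affine subbundle `ṫ = 1`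
(`IsFibreBundle.mem_jetOne_iff`), and elements of `J²Q` are holonomic with `ẗ = 0`. In bundle
coordinates `ξ` therefore extends to all velocities by `ẗ = 0`, `q̈ⁱ = ξⁱ(t, q, q̇)`, which ignores
`ṫ` (`IsAdaptedChart.exists_local_extension`).

At each `v` the requirements on `Ξ v` (holonomic, `ẗ = 0`, equal to `ξ v` on `J¹Q`) are affine, so
they cut out a convex set, and a partition of unity on `TQ` glues the local extensions
(`exists_holonomicExtension`).

The rest is formal. The part of `Ξ(TQ)` with `ṫ = 1` lies over `J¹Q`, where `Ξ = ξ`, so the two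
equations are the same subset of `TTQ`. Along a solution `ṫ = 1` says that `τ ∘ c` has derivative 1,
hence `τ (c s) = s + a`, and a translation of the parameter gives a section. -/

noncomputable section

namespace TimeMechanics

open Set Filter Topology Bundle

/-! ### Topology of `TQ` needed for partitions of unity -/

section Topology

/-- Points over distinct base points are separated in the base, points of one fibre inside a local
trivialization. -/
theorem t2Space_totalSpace {B F : Type*} {V : B → Type*} [TopologicalSpace B] [T2Space B]
    [TopologicalSpace F] [T2Space F] [∀ b, TopologicalSpace (V b)]
    [TopologicalSpace (TotalSpace F V)] [FiberBundle F V] : T2Space (TotalSpace F V) := by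
  refine ⟨fun x y hxy => ?_⟩
  by_cases h : x.proj = y.proj
  · let e := trivializationAt F V x.proj
    have hx : x ∈ e.source := e.mem_source.2 (mem_baseSet_trivializationAt F V x.proj)
    have hy : y ∈ e.source :=
      e.mem_source.2 (h ▸ mem_baseSet_trivializationAt F V x.proj)
    have hne : e x ≠ e y := fun h' => hxy (e.injOn hx hy h')
    obtain ⟨u, v, hu, hv, hxu, hyv, huv⟩ := t2_separation hne
    refine ⟨e.source ∩ e ⁻¹' u, e.source ∩ e ⁻¹' v, e.isOpen_inter_preimage hu,
      e.isOpen_inter_preimage hv, ⟨hx, hxu⟩, ⟨hy, hyv⟩, ?_⟩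
    exact (huv.preimage e).mono inter_subset_right inter_subset_right
  · obtain ⟨u, v, hu, hv, hxu, hyv, huv⟩ := t2_separation h
    have hc := FiberBundle.continuous_proj F V
    exact ⟨_, _, hu.preimage hc, hv.preimage hc, hxu, hyv, huv.preimage _⟩

/-- Countably many charts cover `Q`, and the charts of `TQ` over them cover `TQ`; so `TQ` is second
countable as well as locally compact. -/
theorem sigmaCompactSpace_tangentBundle {E : Type*} [NormedAddCommGroup E] [NormedSpace ℝ E]
    [FiniteDimensional ℝ E] {Q : Type*} [TopologicalSpace Q] [SecondCountableTopology Q]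
    [ChartedSpace E Q] [IsManifold 𝓘(ℝ, E) ∞ Q] :
    SigmaCompactSpace (TangentBundle 𝓘(ℝ, E) Q) := by
  have : ProperSpace E := FiniteDimensional.proper ℝ E
  have : SecondCountableTopology E := secondCountable_of_proper
  obtain ⟨s, hs, hsU⟩ := TopologicalSpace.countable_cover_nhds
    (fun x : Q => chart_source_mem_nhds E x)
  have : SecondCountableTopology (ModelProd E E) :=
    inferInstanceAs (SecondCountableTopology (E × E))
  have : LocallyCompactSpace (ModelProd E E) := inferInstanceAs (LocallyCompactSpace (E × E))
  have : SecondCountableTopology (TangentBundle 𝓘(ℝ, E) Q) := by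
    refine ChartedSpace.secondCountable_of_countable_cover (ModelProd E E)
      (s := (fun q : Q => (⟨q, (0 : E)⟩ : TangentBundle 𝓘(ℝ, E) Q)) '' s) ?_ (hs.image _)
    refine eq_univ_of_forall fun v => ?_
    have hv : v.proj ∈ ⋃ x ∈ s, (chartAt E x).source := hsU ▸ mem_univ _
    obtain ⟨q, hq, hqv⟩ := mem_iUnion₂.1 hv
    exact mem_iUnion₂.2 ⟨_, mem_image_of_mem _ hq, (TangentBundle.mem_chart_source_iff v _).2 hqv⟩
  have : LocallyCompactSpace (TangentBundle 𝓘(ℝ, E) Q) :=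
    ChartedSpace.locallyCompactSpace (ModelProd E E) _
  infer_instance

end Topology

/-! ### Tangent maps and translations of the parameter -/

section TangentMap

variable {E : Type*} [NormedAddCommGroup E] [NormedSpace ℝ E]
  {H : Type*} [TopologicalSpace H] {I : ModelWithCorners ℝ E H}
  {N : Type*} [TopologicalSpace N] [ChartedSpace H N]
  {E' : Type*} [NormedAddCommGroup E'] [NormedSpace ℝ E']
  {H' : Type*} [TopologicalSpace H'] {I' : ModelWithCorners ℝ E' H'}
  {N' : Type*} [TopologicalSpace N'] [ChartedSpace H' N']

theorem contMDiffOn_tangentMap [IsManifold I ∞ N] [IsManifold I' ∞ N'] {f : N → N'} {s : Set N}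
    (hf : ContMDiffOn I I' ∞ f s) (hs : IsOpen s) :
    ContMDiffOn I.tangent I'.tangent ∞ (tangentMap I I' f) (TotalSpace.proj ⁻¹' s) :=
  (hf.contMDiffOn_tangentMapWithin (m := ∞) le_rfl hs.uniqueMDiffOn).congr fun _ hp =>
    (tangentMapWithin_eq_tangentMap (hs.uniqueMDiffOn _ hp)
      ((hf.contMDiffAt (hs.mem_nhds hp)).mdifferentiableAt (by simp))).symm

/-- No differentiability is assumed: translations are invertible, so both curves are differentiable
or both derivatives take the default value 0. -/
theorem mfderiv_comp_sub (c : ℝ → N) (a t : ℝ) :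
    mfderiv 𝓘(ℝ, ℝ) I (fun s => c (s - a)) t (1 : ℝ) = mfderiv 𝓘(ℝ, ℝ) I c (t - a) (1 : ℝ) := by
  have hsub (b r : ℝ) : HasMFDerivAt 𝓘(ℝ, ℝ) 𝓘(ℝ, ℝ) (fun s : ℝ => s - b) r
      (ContinuousLinearMap.id ℝ ℝ) := ((hasFDerivAt_id r).sub_const b).hasMFDerivAt
  by_cases h : MDifferentiableAt 𝓘(ℝ, ℝ) I c (t - a)
  · have := (h.hasMFDerivAt.comp t (hsub a t)).mfderiv
    exact congrArg (fun L : ℝ →L[ℝ] E => L 1) this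
  · have h' : ¬ MDifferentiableAt 𝓘(ℝ, ℝ) I (fun s => c (s - a)) t := by
      refine fun h' => h ?_
      have e : t = t - a - (-a) := by ring
      rw [e] at h'
      have := h'.comp (t - a) (hsub (-a) (t - a)).mdifferentiableAt
      simpa [Function.comp_def] using this
    rw [mfderiv_zero_of_not_mdifferentiableAt h, mfderiv_zero_of_not_mdifferentiableAt h']
    rfl

/-- Lets a coordinate pair (point, vector) be fed smoothly to `tangentMap`. -/
theorem contMDiff_totalSpaceMk_model {G : Type*} [NormedAddCommGroup G] [NormedSpace ℝ G] :
    ContMDiff 𝓘(ℝ, G × G) 𝓘(ℝ, G).tangent ∞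
      (fun z : G × G => (⟨z.1, z.2⟩ : TangentBundle 𝓘(ℝ, G) G)) := by
  intro z
  refine Bundle.contMDiffAt_totalSpace.2 ⟨contDiff_fst.contMDiff.contMDiffAt, ?_⟩
  convert! (contDiff_snd (𝕜 := ℝ) (n := ∞) (E := G) (F := G)).contMDiff.contMDiffAt with y
  simp
  rfl

end TangentMap

/-! ### Bundle charts and `J¹Q` as the subbundle `ṫ = 1` -/

section AdaptedChart

variable {E : Type*} [NormedAddCommGroup E] [NormedSpace ℝ E]
  {Q : Type*} [TopologicalSpace Q] [ChartedSpace E Q]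
  {F : Type*} [NormedAddCommGroup F] [NormedSpace ℝ F]

/-- A smooth bundle chart of `τ`: its first component is the time `τ`. -/
structure IsAdaptedChart (τ : Q → ℝ) (χ : OpenPartialHomeomorph Q (ℝ × F)) : Prop where
  smooth : ContMDiffOn 𝓘(ℝ, E) 𝓘(ℝ, ℝ × F) ∞ χ χ.source
  smooth_symm : ContMDiffOn 𝓘(ℝ, ℝ × F) 𝓘(ℝ, E) ∞ χ.symm χ.target
  fst_eq : ∀ q ∈ χ.source, (χ q).1 = τ q

/-- A local trivialization followed by a chart of `M` on the second factor; the time factor is left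
untouched. -/
theorem IsFibreBundle.exists_adaptedChart {M : Type*} [TopologicalSpace M] [ChartedSpace F M]
    [IsManifold 𝓘(ℝ, F) ∞ M] {τ : Q → ℝ} (hτ : IsFibreBundle (E := E) F M τ) (q : Q) :
    ∃ χ : OpenPartialHomeomorph Q (ℝ × F), q ∈ χ.source ∧ IsAdaptedChart (E := E) τ χ := by
  obtain ⟨U, -, hqU, ψ, hs, -, hfst, hψ, hψs⟩ := hτ.locallyTrivial (τ q)
  have hq : q ∈ ψ.source := hs ▸ hqU
  let φ := chartAt F (ψ q).2
  have hφ : ContMDiffOn 𝓘(ℝ, F) 𝓘(ℝ, F) ∞ φ φ.source := contMDiffOn_chart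
  have hφs : ContMDiffOn 𝓘(ℝ, F) 𝓘(ℝ, F) ∞ φ.symm φ.target := contMDiffOn_chart_symm
  refine ⟨ψ.trans ((OpenPartialHomeomorph.refl ℝ).prod φ), ?_, ?_, ?_, ?_⟩
  · simp [hq, φ]
  · have h1 : ContMDiffOn 𝓘(ℝ, E) 𝓘(ℝ, ℝ) ∞ (fun x => (ψ x).1) ψ.source :=
      contMDiff_fst.comp_contMDiffOn hψ
    have h2 : ContMDiffOn 𝓘(ℝ, E) 𝓘(ℝ, F) ∞ (fun x => (ψ x).2) ψ.source :=
      contMDiff_snd.comp_contMDiffOn hψ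
    refine ContMDiffOn.prodMk_space (h1.mono fun x hx => hx.1) (hφ.comp (h2.mono fun x hx => hx.1) ?_)
    intro x hx
    exact hx.2.2
  · have h1 : ContMDiff 𝓘(ℝ, ℝ × F) 𝓘(ℝ, ℝ) ∞ (Prod.fst : ℝ × F → ℝ) := contDiff_fst.contMDiff
    have h2 : ContMDiff 𝓘(ℝ, ℝ × F) 𝓘(ℝ, F) ∞ (Prod.snd : ℝ × F → F) := contDiff_snd.contMDiff
    refine hψs.comp (h1.contMDiffOn.prodMk (hφs.comp h2.contMDiffOn ?_)) ?_
    · intro x hx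
      exact hx.1.2
    · intro x hx
      exact hx.2
  · intro x hx
    exact hfst x hx.1

variable {τ : Q → ℝ} {χ : OpenPartialHomeomorph Q (ℝ × F)}

namespace IsAdaptedChart

theorem contMDiffAt (hχ : IsAdaptedChart (E := E) τ χ) {q : Q} (hq : q ∈ χ.source) :
    ContMDiffAt 𝓘(ℝ, E) 𝓘(ℝ, ℝ × F) ∞ χ q :=
  hχ.smooth.contMDiffAt (χ.open_source.mem_nhds hq)

theorem contMDiffAt_symm (hχ : IsAdaptedChart (E := E) τ χ) {x : ℝ × F} (hx : x ∈ χ.target) :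
    ContMDiffAt 𝓘(ℝ, ℝ × F) 𝓘(ℝ, E) ∞ χ.symm x :=
  hχ.smooth_symm.contMDiffAt (χ.open_target.mem_nhds hx)

theorem mfderiv_symm_mfderiv (hχ : IsAdaptedChart (E := E) τ χ) {q : Q} (hq : q ∈ χ.source)
    (v : TangentSpace 𝓘(ℝ, E) q) :
    (mfderiv 𝓘(ℝ, ℝ × F) 𝓘(ℝ, E) χ.symm (χ q) (mfderiv 𝓘(ℝ, E) 𝓘(ℝ, ℝ × F) χ q v) : E) = v := by
  have h := mfderiv_comp q
    ((hχ.contMDiffAt_symm (χ.map_source hq)).mdifferentiableAt (by simp))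
    ((hχ.contMDiffAt hq).mdifferentiableAt (by simp))
  have h' : (χ.symm ∘ χ) =ᶠ[𝓝 q] id := χ.eventually_left_inverse hq
  have h3 := h'.mfderiv_eq (I := 𝓘(ℝ, E)) (I' := 𝓘(ℝ, E))
  exact congrArg (fun L : E →L[ℝ] E => L v) (h.symm.trans (h3.trans mfderiv_id))

theorem mfderiv_mfderiv_symm (hχ : IsAdaptedChart (E := E) τ χ) {x : ℝ × F} (hx : x ∈ χ.target)
    (w : ℝ × F) :
    (mfderiv 𝓘(ℝ, E) 𝓘(ℝ, ℝ × F) χ (χ.symm x) (mfderiv 𝓘(ℝ, ℝ × F) 𝓘(ℝ, E) χ.symm x w)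
      : ℝ × F) = w := by
  have hq := χ.map_target hx
  have h := mfderiv_comp x
    ((hχ.contMDiffAt hq).mdifferentiableAt (by simp))
    ((hχ.contMDiffAt_symm hx).mdifferentiableAt (by simp))
  have h' : (χ ∘ χ.symm) =ᶠ[𝓝 x] id := χ.eventually_right_inverse hx
  have h3 := h'.mfderiv_eq (I := 𝓘(ℝ, ℝ × F)) (I' := 𝓘(ℝ, ℝ × F))
  exact congrArg (fun L : ℝ × F →L[ℝ] ℝ × F => L w) (h.symm.trans (h3.trans mfderiv_id))

/-- Differentiate `Prod.fst ∘ χ = τ`, valid near `q`. -/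
theorem fst_mfderiv (hχ : IsAdaptedChart (E := E) τ χ) {q : Q} (hq : q ∈ χ.source)
    (v : TangentSpace 𝓘(ℝ, E) q) :
    (mfderiv 𝓘(ℝ, E) 𝓘(ℝ, ℝ × F) χ q v : ℝ × F).1 = tDot (E := E) τ ⟨q, v⟩ := by
  have h1 : HasMFDerivAt 𝓘(ℝ, ℝ × F) 𝓘(ℝ, ℝ) Prod.fst (χ q) (ContinuousLinearMap.fst ℝ ℝ F) :=
    hasFDerivAt_fst.hasMFDerivAt
  have h := (h1.comp q ((hχ.contMDiffAt hq).mdifferentiableAt (by simp)).hasMFDerivAt).mfderiv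
  have h' : (Prod.fst ∘ χ) =ᶠ[𝓝 q] τ := by
    filter_upwards [χ.open_source.mem_nhds hq] with x hx using hχ.fst_eq x hx
  have h3 := h'.mfderiv_eq (I := 𝓘(ℝ, E)) (I' := 𝓘(ℝ, ℝ))
  exact congrArg (fun L : E →L[ℝ] ℝ => L v) (h.symm.trans h3)

end IsAdaptedChart

theorem velocity_comp_sub (c : ℝ → Q) (a : ℝ) :
    velocity (E := E) (fun s => c (s - a)) = fun s => velocity (E := E) c (s - a) :=
  funext fun t => congrArg (TotalSpace.mk (c (t - a))) (mfderiv_comp_sub (I := 𝓘(ℝ, E)) c a t)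

theorem tDot_velocity {τ : Q → ℝ} {s : ℝ → Q} {t : ℝ}
    (hτ : ContMDiff 𝓘(ℝ, E) 𝓘(ℝ, ℝ) ∞ τ) (hs : MDifferentiableAt 𝓘(ℝ, ℝ) 𝓘(ℝ, E) s t) :
    tDot (E := E) τ (velocity (E := E) s t) = deriv (τ ∘ s) t := by
  have h := mfderiv_comp t (hτ.mdifferentiableAt (by simp)) hs
  rw [mfderiv_eq_fderiv] at h
  exact (congrArg (fun L : ℝ →L[ℝ] ℝ => L 1) h).symm

/-- The image of `J¹Q` in `TQ` is the affine subbundle `ṫ = 1`. -/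
theorem IsFibreBundle.mem_jetOne_iff {M : Type*} [TopologicalSpace M] [ChartedSpace F M]
    [IsManifold 𝓘(ℝ, F) ∞ M] (hτ : IsFibreBundle (E := E) F M τ)
    (v : TangentBundle 𝓘(ℝ, E) Q) : v ∈ jetOne (E := E) τ ↔ tDot (E := E) τ v = 1 := by
  constructor
  · rintro ⟨t, s, ⟨U, hU, htU, hs, hτs⟩, rfl⟩
    rw [tDot_velocity hτ.smooth
      ((hs.contMDiffAt (hU.mem_nhds htU)).mdifferentiableAt (by simp))]
    have h : τ ∘ s =ᶠ[𝓝 t] id := by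
      filter_upwards [hU.mem_nhds htU] with r hr using hτs r hr
    rw [h.deriv_eq, deriv_id]
  · obtain ⟨q, v⟩ := v
    intro hv
    obtain ⟨χ, hq, hχ⟩ := hτ.exists_adaptedChart q
    let u : ℝ × F := mfderiv 𝓘(ℝ, E) 𝓘(ℝ, ℝ × F) χ q v
    have hu : u.1 = 1 := (hχ.fst_mfderiv hq v).trans hv
    -- The straight line through `χ q` with velocity `u`, timed to pass there at `τ q`. Since `u.1 =
    -- 1`, its time coordinate equals its parameter, so `χ.symm ∘ γ` is a local section.
    let γ : ℝ → ℝ × F := fun r => χ q + (r - τ q) • u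
    have hγ : ContDiff ℝ ∞ γ := by fun_prop
    have hγ0 : γ (τ q) = χ q := by simp [γ]
    have hγ' : HasMFDerivAt 𝓘(ℝ, ℝ) 𝓘(ℝ, ℝ × F) γ (τ q)
        (ContinuousLinearMap.toSpanSingleton ℝ u) := by
      have : HasDerivAt γ u (τ q) := by
        have h := (((hasDerivAt_id (τ q)).sub_const (τ q)).smul_const u).const_add (χ q)
        rwa [one_smul] at h
      exact this.hasFDerivAt.hasMFDerivAt
    have hmaps : γ (τ q) ∈ χ.target := hγ0 ▸ χ.map_source hq
    refine ⟨τ q, χ.symm ∘ γ, ⟨γ ⁻¹' χ.target, χ.open_target.preimage hγ.continuous, hmaps,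
      hχ.smooth_symm.comp hγ.contMDiff.contMDiffOn fun _ h => h, fun r hr => ?_⟩, ?_⟩
    · rw [Function.comp_apply, ← hχ.fst_eq _ (χ.map_target hr), χ.right_inv hr]
      simp [γ, hu, hχ.fst_eq q hq]
    · have h := (((hχ.contMDiffAt_symm hmaps).mdifferentiableAt (by simp)).hasMFDerivAt.comp
        (τ q) hγ').mfderiv
      have hval : (mfderiv 𝓘(ℝ, ℝ) 𝓘(ℝ, E) (χ.symm ∘ γ) (τ q) (1 : ℝ) : E) = v := by
        have h1 := congrArg (fun L : ℝ →L[ℝ] E => L 1) h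
        refine h1.trans (Eq.trans ?_ (hχ.mfderiv_symm_mfderiv hq v))
        rw [hγ0]
        exact congrArg (fun x => (mfderiv 𝓘(ℝ, ℝ × F) 𝓘(ℝ, E) χ.symm (χ q) : ℝ × F →L[ℝ] E) x)
          (one_smul ℝ u)
      have hpt : (χ.symm ∘ γ) (τ q) = q := by simp [hγ0, χ.left_inv hq]
      refine TotalSpace.ext hpt ?_
      exact heq_of_eq hval

end AdaptedChart

/-! ### Prolonged curves and the constraints satisfied on `J²Q` -/

section Prolongation

variable {E : Type*} [NormedAddCommGroup E] [NormedSpace ℝ E]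
  {Q : Type*} [TopologicalSpace Q] [ChartedSpace E Q] [IsManifold 𝓘(ℝ, E) ∞ Q]

theorem contMDiff_tDot {τ : Q → ℝ} (hτ : ContMDiff 𝓘(ℝ, E) 𝓘(ℝ, ℝ) ∞ τ) :
    ContMDiff 𝓘(ℝ, E).tangent 𝓘(ℝ, ℝ) ∞ (tDot (E := E) τ) :=
  (contMDiff_snd_tangentBundle_modelSpace ℝ 𝓘(ℝ, ℝ)).comp
    (hτ.contMDiff_tangentMap (m := ∞) le_rfl)

theorem contMDiffOn_velocity {c : ℝ → Q} {J : Set ℝ}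
    (hc : ContMDiffOn 𝓘(ℝ, ℝ) 𝓘(ℝ, E) ∞ c J) (hJ : IsOpen J) :
    ContMDiffOn 𝓘(ℝ, ℝ) 𝓘(ℝ, E).tangent ∞ (velocity (E := E) c) J := by
  have h : ContMDiff 𝓘(ℝ, ℝ) 𝓘(ℝ, ℝ).tangent ∞
      (fun t : ℝ => (⟨t, (1 : ℝ)⟩ : TangentBundle 𝓘(ℝ, ℝ) ℝ)) :=
    (contMDiff_totalSpaceMk_model (G := ℝ)).comp
      (contDiff_id.prodMk contDiff_const : ContDiff ℝ ∞ fun t : ℝ => (t, (1 : ℝ))).contMDiff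
  exact (contMDiffOn_tangentMap hc hJ).comp h.contMDiffOn fun t ht => ht

/-- Differentiate `proj ∘ ṡ = s`. -/
theorem mfderiv_proj_of_mem_jetTwo {τ : Q → ℝ}
    {w : TangentBundle 𝓘(ℝ, E).tangent (TangentBundle 𝓘(ℝ, E) Q)}
    (hw : w ∈ jetTwo (E := E) τ) :
    mfderiv 𝓘(ℝ, E).tangent 𝓘(ℝ, E) (fun u : TangentBundle 𝓘(ℝ, E) Q => u.proj) w.proj w.2 =
      w.proj.2 := by
  obtain ⟨t, s, ⟨U, hU, htU, hs, -⟩, rfl⟩ := hw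
  have h := mfderiv_comp t
    ((contMDiff_proj (n := ∞) (TangentSpace 𝓘(ℝ, E) : Q → Type _)).mdifferentiableAt (by simp)
      (x := velocity (E := E) s t))
    (((contMDiffOn_velocity hs hU).contMDiffAt (hU.mem_nhds htU)).mdifferentiableAt (by simp))
  exact (congrArg (fun L : ℝ →L[ℝ] E => L 1) h).symm

/-- Along a section `ṫ` is constantly 1, so its derivative along `s̈` vanishes. -/
theorem tDDot_of_mem_jetTwo {τ : Q → ℝ} (hτ : ContMDiff 𝓘(ℝ, E) 𝓘(ℝ, ℝ) ∞ τ)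
    {w : TangentBundle 𝓘(ℝ, E).tangent (TangentBundle 𝓘(ℝ, E) Q)}
    (hw : w ∈ jetTwo (E := E) τ) : tDDot (E := E) τ w = 0 := by
  obtain ⟨t, s, ⟨U, hU, htU, hs, hτs⟩, rfl⟩ := hw
  have h := mfderiv_comp t
    ((contMDiff_tDot hτ).mdifferentiableAt (by simp) (x := velocity (E := E) s t))
    (((contMDiffOn_velocity hs hU).contMDiffAt (hU.mem_nhds htU)).mdifferentiableAt (by simp))
  have h1 : tDot (E := E) τ ∘ velocity (E := E) s =ᶠ[𝓝 t] fun _ => (1 : ℝ) := by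
    filter_upwards [hU.mem_nhds htU] with r hr
    have h2 : τ ∘ s =ᶠ[𝓝 r] id := by
      filter_upwards [hU.mem_nhds hr] with r' hr' using hτs r' hr'
    rw [Function.comp_apply, tDot_velocity hτ
      ((hs.contMDiffAt (hU.mem_nhds hr)).mdifferentiableAt (by simp)), h2.deriv_eq, deriv_id]
  have h3 := (h1.mfderiv_eq (I := 𝓘(ℝ, ℝ)) (I' := 𝓘(ℝ, ℝ))).trans mfderiv_const
  exact congrArg (fun L : ℝ →L[ℝ] ℝ => L 1) (h.symm.trans h3)

end Prolongation

/-! ### Charts of `TQ` induced by charts of `Q` -/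

section TangentChart

variable {E : Type*} [NormedAddCommGroup E] [NormedSpace ℝ E]
  {Q : Type*} [TopologicalSpace Q] [ChartedSpace E Q]
  {G : Type*} [NormedAddCommGroup G] [NormedSpace ℝ G]

/-- The chart of `TQ` induced by a vector space valued chart of `Q`. -/
def tangentChart (χ : OpenPartialHomeomorph Q G) (v : TangentBundle 𝓘(ℝ, E) Q) : G × G :=
  (χ v.proj, mfderiv 𝓘(ℝ, E) 𝓘(ℝ, G) χ v.proj v.2)

/-- The inverse of the chart of `TQ` induced by a vector space valued chart of `Q`. -/
def tangentChartSymm (χ : OpenPartialHomeomorph Q G) (z : G × G) : TangentBundle 𝓘(ℝ, E) Q :=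
  ⟨χ.symm z.1, mfderiv 𝓘(ℝ, G) 𝓘(ℝ, E) χ.symm z.1 z.2⟩

variable [IsManifold 𝓘(ℝ, E) ∞ Q] {χ : OpenPartialHomeomorph Q G}

theorem contMDiffOn_tangentChart (hχ : ContMDiffOn 𝓘(ℝ, E) 𝓘(ℝ, G) ∞ χ χ.source) :
    ContMDiffOn 𝓘(ℝ, E).tangent 𝓘(ℝ, G × G) ∞ (tangentChart (E := E) χ)
      (TotalSpace.proj ⁻¹' χ.source) := by
  refine ContMDiffOn.prodMk_space ?_ ?_
  · exact hχ.comp (contMDiff_proj (TangentSpace 𝓘(ℝ, E) : Q → Type _)).contMDiffOn fun _ h => h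
  · exact (contMDiff_snd_tangentBundle_modelSpace G 𝓘(ℝ, G)).comp_contMDiffOn
      (contMDiffOn_tangentMap hχ χ.open_source)

theorem contMDiffOn_tangentChartSymm (hχ : ContMDiffOn 𝓘(ℝ, G) 𝓘(ℝ, E) ∞ χ.symm χ.target) :
    ContMDiffOn 𝓘(ℝ, G × G) 𝓘(ℝ, E).tangent ∞ (tangentChartSymm (E := E) χ)
      (Prod.fst ⁻¹' χ.target) :=
  (contMDiffOn_tangentMap hχ χ.open_target).comp contMDiff_totalSpaceMk_model.contMDiffOn
    fun _ h => h

end TangentChart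

/-! ### Extension of `ξ` over a bundle chart -/

section LocalExtension

variable {E : Type*} [NormedAddCommGroup E] [NormedSpace ℝ E]
  {Q : Type*} [TopologicalSpace Q] [ChartedSpace E Q]
  {F : Type*} [NormedAddCommGroup F] [NormedSpace ℝ F]
  {τ : Q → ℝ} {χ : OpenPartialHomeomorph Q (ℝ × F)}

namespace IsAdaptedChart

theorem tangentChartSymm_tangentChart (hχ : IsAdaptedChart (E := E) τ χ)
    {v : TangentBundle 𝓘(ℝ, E) Q} (hv : v.proj ∈ χ.source) :
    tangentChartSymm (E := E) χ (tangentChart χ v) = v :=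
  TotalSpace.ext (χ.left_inv hv) (heq_of_eq (hχ.mfderiv_symm_mfderiv hv v.2))

theorem tangentChart_tangentChartSymm (hχ : IsAdaptedChart (E := E) τ χ)
    {z : (ℝ × F) × (ℝ × F)} (hz : z.1 ∈ χ.target) :
    tangentChart χ (tangentChartSymm (E := E) χ z) = z :=
  Prod.ext (χ.right_inv hz) (hχ.mfderiv_mfderiv_symm hz z.2)

theorem tDot_tangentChartSymm (hχ : IsAdaptedChart (E := E) τ χ)
    {z : (ℝ × F) × (ℝ × F)} (hz : z.1 ∈ χ.target) :
    tDot (E := E) τ (tangentChartSymm (E := E) χ z) = z.2.1 := by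
  have h := hχ.fst_mfderiv (χ.map_target hz) (tangentChartSymm (E := E) χ z).2
  exact h.symm.trans (congrArg Prod.fst (hχ.mfderiv_mfderiv_symm hz z.2))

variable [IsManifold 𝓘(ℝ, E) ∞ Q]

theorem mdifferentiableAt_tangentChart (hχ : IsAdaptedChart (E := E) τ χ)
    {v : TangentBundle 𝓘(ℝ, E) Q} (hv : v.proj ∈ χ.source) :
    MDifferentiableAt 𝓘(ℝ, E).tangent 𝓘(ℝ, (ℝ × F) × (ℝ × F)) (tangentChart χ) v :=
  ((contMDiffOn_tangentChart hχ.smooth).contMDiffAt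
    ((χ.open_source.preimage (FiberBundle.continuous_proj E _)).mem_nhds hv)).mdifferentiableAt
      (by simp)

theorem mdifferentiableAt_tangentChartSymm (hχ : IsAdaptedChart (E := E) τ χ)
    {z : (ℝ × F) × (ℝ × F)} (hz : z.1 ∈ χ.target) :
    MDifferentiableAt 𝓘(ℝ, (ℝ × F) × (ℝ × F)) 𝓘(ℝ, E).tangent (tangentChartSymm (E := E) χ) z :=
  ((contMDiffOn_tangentChartSymm hχ.smooth_symm).contMDiffAt
    ((χ.open_target.preimage continuous_fst).mem_nhds hz)).mdifferentiableAt (by simp)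

theorem mfderiv_tangentChartSymm_mfderiv (hχ : IsAdaptedChart (E := E) τ χ)
    {v : TangentBundle 𝓘(ℝ, E) Q} (hv : v.proj ∈ χ.source)
    (w : TangentSpace 𝓘(ℝ, E).tangent v) :
    (mfderiv 𝓘(ℝ, (ℝ × F) × (ℝ × F)) 𝓘(ℝ, E).tangent (tangentChartSymm (E := E) χ)
      (tangentChart χ v)
      (mfderiv 𝓘(ℝ, E).tangent 𝓘(ℝ, (ℝ × F) × (ℝ × F)) (tangentChart χ) v w) : E × E) = w := by
  have h := mfderiv_comp v (hχ.mdifferentiableAt_tangentChartSymm (z := tangentChart χ v)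
    (χ.map_source hv)) (hχ.mdifferentiableAt_tangentChart hv)
  have h' : (tangentChartSymm (E := E) χ ∘ tangentChart χ) =ᶠ[𝓝 v] id := by
    filter_upwards [(χ.open_source.preimage (FiberBundle.continuous_proj E _)).mem_nhds hv]
      with x hx using hχ.tangentChartSymm_tangentChart hx
  have h3 := h'.mfderiv_eq (I := 𝓘(ℝ, E).tangent) (I' := 𝓘(ℝ, E).tangent)
  exact congrArg (fun L : E × E →L[ℝ] E × E => L w) (h.symm.trans (h3.trans mfderiv_id))

/-- Both sides differentiate `χ ∘ proj`. For holonomic `w` the base component is thus the velocity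
coordinate of `v`. -/
theorem fst_mfderiv_tangentChart (hχ : IsAdaptedChart (E := E) τ χ)
    {v : TangentBundle 𝓘(ℝ, E) Q} (hv : v.proj ∈ χ.source)
    (w : TangentSpace 𝓘(ℝ, E).tangent v) :
    (mfderiv 𝓘(ℝ, E).tangent 𝓘(ℝ, (ℝ × F) × (ℝ × F)) (tangentChart χ) v w
      : (ℝ × F) × (ℝ × F)).1 =
    mfderiv 𝓘(ℝ, E) 𝓘(ℝ, ℝ × F) χ v.proj
      (mfderiv 𝓘(ℝ, E).tangent 𝓘(ℝ, E) (fun u : TangentBundle 𝓘(ℝ, E) Q => u.proj) v w) := by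
  have h1 : HasMFDerivAt 𝓘(ℝ, (ℝ × F) × (ℝ × F)) 𝓘(ℝ, ℝ × F) Prod.fst (tangentChart χ v)
      (ContinuousLinearMap.fst ℝ (ℝ × F) (ℝ × F)) := hasFDerivAt_fst.hasMFDerivAt
  have h := (h1.comp v (hχ.mdifferentiableAt_tangentChart hv).hasMFDerivAt).mfderiv
  have h' := mfderiv_comp v ((hχ.contMDiffAt hv).mdifferentiableAt (by simp))
    ((contMDiff_proj (n := ∞) (TangentSpace 𝓘(ℝ, E) : Q → Type _)).mdifferentiableAt (by simp)
      (x := v))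
  exact congrArg (fun L : E × E →L[ℝ] ℝ × F => L w) (h.symm.trans h')

theorem snd_fst_mfderiv_tangentChart (hχ : IsAdaptedChart (E := E) τ χ)
    {v : TangentBundle 𝓘(ℝ, E) Q} (hv : v.proj ∈ χ.source)
    (w : TangentSpace 𝓘(ℝ, E).tangent v) :
    (mfderiv 𝓘(ℝ, E).tangent 𝓘(ℝ, (ℝ × F) × (ℝ × F)) (tangentChart χ) v w
      : (ℝ × F) × (ℝ × F)).2.1 = tDDot (E := E) τ ⟨v, w⟩ := by
  have h1 : HasMFDerivAt 𝓘(ℝ, (ℝ × F) × (ℝ × F)) 𝓘(ℝ, ℝ) (fun z => z.2.1) (tangentChart χ v)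
      ((ContinuousLinearMap.fst ℝ ℝ F).comp (ContinuousLinearMap.snd ℝ (ℝ × F) (ℝ × F))) :=
    (hasFDerivAt_fst.comp _ hasFDerivAt_snd).hasMFDerivAt
  have h := (h1.comp v (hχ.mdifferentiableAt_tangentChart hv).hasMFDerivAt).mfderiv
  have h' : ((fun z : (ℝ × F) × (ℝ × F) => z.2.1) ∘ tangentChart χ) =ᶠ[𝓝 v]
      tDot (E := E) τ := by
    filter_upwards [(χ.open_source.preimage (FiberBundle.continuous_proj E _)).mem_nhds hv]
      with x hx using hχ.fst_mfderiv hx x.2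
  have h3 := h'.mfderiv_eq (I := 𝓘(ℝ, E).tangent) (I' := 𝓘(ℝ, ℝ))
  exact congrArg (fun L : E × E →L[ℝ] ℝ => L w) (h.symm.trans h3)

/-- Both sides differentiate `χ.symm ∘ Prod.fst`. It makes a coordinate vector `y` at `z` holonomic
as soon as `y.1 = z.2`. -/
theorem mfderiv_proj_tangentChartSymm (hχ : IsAdaptedChart (E := E) τ χ)
    {z : (ℝ × F) × (ℝ × F)} (hz : z.1 ∈ χ.target) (y : (ℝ × F) × (ℝ × F)) :
    (mfderiv 𝓘(ℝ, E).tangent 𝓘(ℝ, E) (fun u : TangentBundle 𝓘(ℝ, E) Q => u.proj)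
      (tangentChartSymm χ z)
      (mfderiv 𝓘(ℝ, (ℝ × F) × (ℝ × F)) 𝓘(ℝ, E).tangent (tangentChartSymm (E := E) χ) z y) : E) =
    mfderiv 𝓘(ℝ, ℝ × F) 𝓘(ℝ, E) χ.symm z.1 y.1 := by
  have h1 : HasMFDerivAt 𝓘(ℝ, (ℝ × F) × (ℝ × F)) 𝓘(ℝ, ℝ × F) Prod.fst z
      (ContinuousLinearMap.fst ℝ (ℝ × F) (ℝ × F)) := hasFDerivAt_fst.hasMFDerivAt
  have h := (((hχ.contMDiffAt_symm hz).mdifferentiableAt (by simp)).hasMFDerivAt.comp z h1).mfderiv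
  have h' := mfderiv_comp z
    ((contMDiff_proj (n := ∞) (TangentSpace 𝓘(ℝ, E) : Q → Type _)).mdifferentiableAt (by simp)
      (x := tangentChartSymm (E := E) χ z)) (hχ.mdifferentiableAt_tangentChartSymm hz)
  exact congrArg (fun L : (ℝ × F) × (ℝ × F) →L[ℝ] E => L y) (h'.symm.trans h)

/-- In these coordinates `ṫ` is the linear function `z.2.1`, so `ẗ` is the matching component of
`y`. -/
theorem tDDot_tangentChartSymm (hχ : IsAdaptedChart (E := E) τ χ)
    (hτ : ContMDiff 𝓘(ℝ, E) 𝓘(ℝ, ℝ) ∞ τ)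
    {z : (ℝ × F) × (ℝ × F)} (hz : z.1 ∈ χ.target) (y : (ℝ × F) × (ℝ × F)) :
    tDDot (E := E) τ ⟨tangentChartSymm χ z,
      mfderiv 𝓘(ℝ, (ℝ × F) × (ℝ × F)) 𝓘(ℝ, E).tangent (tangentChartSymm (E := E) χ) z y⟩ =
    y.2.1 := by
  have h1 : HasMFDerivAt 𝓘(ℝ, (ℝ × F) × (ℝ × F)) 𝓘(ℝ, ℝ) (fun z => z.2.1) z
      ((ContinuousLinearMap.fst ℝ ℝ F).comp (ContinuousLinearMap.snd ℝ (ℝ × F) (ℝ × F))) :=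
    (hasFDerivAt_fst.comp _ hasFDerivAt_snd).hasMFDerivAt
  have h := mfderiv_comp z ((contMDiff_tDot hτ).mdifferentiableAt (by simp)
    (x := tangentChartSymm (E := E) χ z)) (hχ.mdifferentiableAt_tangentChartSymm hz)
  have h' : (tDot (E := E) τ ∘ tangentChartSymm χ) =ᶠ[𝓝 z] (fun z => z.2.1) := by
    filter_upwards [(χ.open_target.preimage continuous_fst).mem_nhds hz]
      with x hx using hχ.tDot_tangentChartSymm hx
  have h3 := h'.mfderiv_eq (I := 𝓘(ℝ, (ℝ × F) × (ℝ × F))) (I' := 𝓘(ℝ, ℝ))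
  exact congrArg (fun L : (ℝ × F) × (ℝ × F) →L[ℝ] ℝ => L y) (h.symm.trans (h3.trans h1.mfderiv))

end IsAdaptedChart

variable [IsManifold 𝓘(ℝ, E) ∞ Q]

/-- The holonomic tangent vectors of `TQ` at `v` with `ẗ = 0` which agree with `ξ` on `J¹Q`. -/
def holonomicExtensions (τ : Q → ℝ)
    (ξ : ∀ v : TangentBundle 𝓘(ℝ, E) Q, TangentSpace 𝓘(ℝ, E).tangent v)
    (v : TangentBundle 𝓘(ℝ, E) Q) : Set (TangentSpace 𝓘(ℝ, E).tangent v) :=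
  {w | mfderiv 𝓘(ℝ, E).tangent 𝓘(ℝ, E) (fun u : TangentBundle 𝓘(ℝ, E) Q => u.proj) v w = v.2 ∧
    tDDot (E := E) τ ⟨v, w⟩ = 0 ∧ (v ∈ jetOne (E := E) τ → w = ξ v)}

/-- All three conditions are affine: only `a + b = 1` is used, not the signs of `a` and `b`. -/
theorem convex_holonomicExtensions (τ : Q → ℝ)
    (ξ : ∀ v : TangentBundle 𝓘(ℝ, E) Q, TangentSpace 𝓘(ℝ, E).tangent v)
    (v : TangentBundle 𝓘(ℝ, E) Q) : Convex ℝ (holonomicExtensions (E := E) τ ξ v) := by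
  rintro w ⟨h1, h2, h3⟩ w' ⟨h1', h2', h3'⟩ a b - - hab
  refine ⟨?_, ?_, fun hv => ?_⟩
  · rw [map_add, map_smul, map_smul, h1, h1', ← add_smul, hab, one_smul]
  · let L : TangentSpace 𝓘(ℝ, E).tangent v →L[ℝ] ℝ :=
      mfderiv 𝓘(ℝ, E).tangent 𝓘(ℝ, ℝ) (tDot (E := E) τ) v
    change L w = 0 at h2
    change L w' = 0 at h2'
    change L (a • w + b • w') = 0
    rw [map_add, map_smul, map_smul, h2, h2', smul_zero, smul_zero, add_zero]
  · rw [h3 hv, h3' hv, ← add_smul, hab, one_smul]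

variable {ξ : ∀ v : TangentBundle 𝓘(ℝ, E) Q, TangentSpace 𝓘(ℝ, E).tangent v}

/-- In bundle coordinates, the vertical accelerations of a holonomic connection, extended to all
velocities by forgetting the component `ṫ`. -/
theorem IsAdaptedChart.contDiffOn_acceleration (hχ : IsAdaptedChart (E := E) τ χ)
    (hJ : ∀ v, v ∈ jetOne (E := E) τ ↔ tDot (E := E) τ v = 1)
    (hξ : IsHolonomicConnection (E := E) τ ξ) :
    ContDiffOn ℝ ∞ (fun z : (ℝ × F) × (ℝ × F) =>
      (mfderiv 𝓘(ℝ, E).tangent 𝓘(ℝ, (ℝ × F) × (ℝ × F)) (tangentChart χ)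
        (tangentChartSymm (E := E) χ (z.1, (1, z.2.2)))
        (ξ (tangentChartSymm (E := E) χ (z.1, (1, z.2.2)))) : (ℝ × F) × (ℝ × F)).2.2)
      (Prod.fst ⁻¹' χ.target) := by
  have hP : ContDiff ℝ ∞ (fun z : (ℝ × F) × (ℝ × F) => (z.1, ((1 : ℝ), z.2.2))) := by fun_prop
  have h1 : ContMDiffOn 𝓘(ℝ, (ℝ × F) × (ℝ × F)) 𝓘(ℝ, E).tangent ∞
      (fun z : (ℝ × F) × (ℝ × F) => tangentChartSymm (E := E) χ (z.1, (1, z.2.2))) (Prod.fst ⁻¹' χ.target) :=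
    (contMDiffOn_tangentChartSymm hχ.smooth_symm).comp hP.contMDiff.contMDiffOn fun _ h => h
  -- Resetting `ṫ` to 1 lands in `J¹Q`, the only place where `ξ` is known to be smooth.
  have h2 := hξ.smooth.comp h1 fun z hz => (hJ _).2 (hχ.tDot_tangentChartSymm hz)
  have h3 := (contMDiffOn_tangentMap (contMDiffOn_tangentChart hχ.smooth)
    (χ.open_source.preimage (FiberBundle.continuous_proj E _))).comp h2
      fun z hz => χ.map_target hz
  have h4 := ((contMDiff_snd_tangentBundle_modelSpace ((ℝ × F) × (ℝ × F))
    𝓘(ℝ, (ℝ × F) × (ℝ × F))).comp_contMDiffOn h3).contDiffOn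
  exact contDiff_snd.comp_contDiffOn (contDiff_snd.comp_contDiffOn h4)

theorem IsAdaptedChart.exists_local_extension (hχ : IsAdaptedChart (E := E) τ χ)
    (hτ : ContMDiff 𝓘(ℝ, E) 𝓘(ℝ, ℝ) ∞ τ)
    (hJ : ∀ v, v ∈ jetOne (E := E) τ ↔ tDot (E := E) τ v = 1)
    (hξ : IsHolonomicConnection (E := E) τ ξ) :
    ∃ Ξ : ∀ v : TangentBundle 𝓘(ℝ, E) Q, TangentSpace 𝓘(ℝ, E).tangent v,
      ContMDiffOn 𝓘(ℝ, E).tangent 𝓘(ℝ, E).tangent.tangent ∞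
        (fun v => (⟨v, Ξ v⟩ : TangentBundle 𝓘(ℝ, E).tangent (TangentBundle 𝓘(ℝ, E) Q)))
        (TotalSpace.proj ⁻¹' χ.source) ∧
      ∀ v : TangentBundle 𝓘(ℝ, E) Q, v.proj ∈ χ.source →
        Ξ v ∈ holonomicExtensions (E := E) τ ξ v := by
  let b : (ℝ × F) × (ℝ × F) → F := fun z =>
      (mfderiv 𝓘(ℝ, E).tangent 𝓘(ℝ, (ℝ × F) × (ℝ × F)) (tangentChart χ)
        (tangentChartSymm (E := E) χ (z.1, (1, z.2.2)))
        (ξ (tangentChartSymm (E := E) χ (z.1, (1, z.2.2)))) : (ℝ × F) × (ℝ × F)).2.2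
  have hb : ContDiffOn ℝ ∞ b (Prod.fst ⁻¹' χ.target) := hχ.contDiffOn_acceleration hJ hξ
  let D : (ℝ × F) × (ℝ × F) → (ℝ × F) × (ℝ × F) → E × E := fun z y =>
    mfderiv 𝓘(ℝ, (ℝ × F) × (ℝ × F)) 𝓘(ℝ, E).tangent (tangentChartSymm (E := E) χ) z y
  -- The coordinates of `Ξ`: base component equal to the velocity (holonomy), `ẗ = 0`, and
  -- acceleration `b`, in which `ṫ` is replaced by 1.
  let Y : (ℝ × F) × (ℝ × F) → (ℝ × F) × (ℝ × F) := fun z => (z.2, ((0 : ℝ), b z))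
  have hY : ContDiffOn ℝ ∞ Y (Prod.fst ⁻¹' χ.target) :=
    contDiff_snd.contDiffOn.prodMk (contDiffOn_const.prodMk hb)
  refine ⟨fun v => D (tangentChart χ v) (Y (tangentChart χ v)), ?_, fun v hv => ?_⟩
  · have h1 := contMDiff_totalSpaceMk_model.comp_contMDiffOn
      (contDiffOn_id.prodMk hY).contMDiffOn
    have h2 := (contMDiffOn_tangentMap (contMDiffOn_tangentChartSymm (E := E) hχ.smooth_symm)
      (χ.open_target.preimage continuous_fst)).comp h1 fun _ h => h
    refine (h2.comp (contMDiffOn_tangentChart hχ.smooth) fun v hv => χ.map_source hv).congr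
      fun v hv => ?_
    exact TotalSpace.ext (hχ.tangentChartSymm_tangentChart hv).symm HEq.rfl
  · obtain ⟨z, hz, rfl⟩ : ∃ z : (ℝ × F) × (ℝ × F), z.1 ∈ χ.target ∧
        tangentChartSymm χ z = v :=
      ⟨tangentChart χ v, χ.map_source hv, hχ.tangentChartSymm_tangentChart hv⟩
    have hD := congrArg (fun y => D y (Y y)) (hχ.tangentChart_tangentChartSymm hz)
    refine ⟨?_, ?_, fun hvJ => ?_⟩
    · let L : E × E →L[ℝ] E := mfderiv 𝓘(ℝ, E).tangent 𝓘(ℝ, E)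
        (fun u : TangentBundle 𝓘(ℝ, E) Q => u.proj) (tangentChartSymm χ z)
      exact (congrArg L hD).trans (hχ.mfderiv_proj_tangentChartSymm hz (Y z))
    · let L : E × E →L[ℝ] ℝ := mfderiv 𝓘(ℝ, E).tangent 𝓘(ℝ, ℝ) (tDot (E := E) τ)
        (tangentChartSymm χ z)
      exact (congrArg L hD).trans (hχ.tDDot_tangentChartSymm hτ hz (Y z))
    -- On `J¹Q` it suffices to compare `Y z` with the coordinates of `ξ`. Membership in `J²Q` fixes
    -- the base and `ẗ` components; the last ones agree because `ṫ = 1` already holds at `z`.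
    · refine Eq.trans ?_ (hχ.mfderiv_tangentChartSymm_mfderiv hv
        (ξ (tangentChartSymm (E := E) χ z)))
      refine congrArg (D (tangentChart χ (tangentChartSymm (E := E) χ z))) ?_
      rw [hχ.tangentChart_tangentChartSymm hz]
      have hz1 : z.2.1 = 1 := (hχ.tDot_tangentChartSymm hz).symm.trans ((hJ _).1 hvJ)
      have hPz : (z.1, ((1 : ℝ), z.2.2)) = z := by rw [← hz1]
      have hw := hξ.holonomic _ hvJ
      refine Prod.ext ?_ (Prod.ext ?_ ?_)
      · refine Eq.trans ?_ (hχ.fst_mfderiv_tangentChart hv _).symm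
        rw [mfderiv_proj_of_mem_jetTwo hw]
        exact (hχ.mfderiv_mfderiv_symm hz z.2).symm
      · exact ((hχ.snd_fst_mfderiv_tangentChart hv _).trans (tDDot_of_mem_jetTwo hτ hw)).symm
      · exact congrArg (fun z : (ℝ × F) × (ℝ × F) =>
          (mfderiv 𝓘(ℝ, E).tangent 𝓘(ℝ, (ℝ × F) × (ℝ × F)) (tangentChart χ)
            (tangentChartSymm (E := E) χ z) (ξ (tangentChartSymm χ z)) :
            (ℝ × F) × (ℝ × F)).2.2) hPz

end LocalExtension

/-! ### Gluing, and comparison of the equations and their solutions -/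

section GlobalExtension

variable {E : Type*} [NormedAddCommGroup E] [NormedSpace ℝ E]
  {Q : Type*} [TopologicalSpace Q] [ChartedSpace E Q] [IsManifold 𝓘(ℝ, E) ∞ Q]
  {F : Type*} [NormedAddCommGroup F] [NormedSpace ℝ F]
  {M : Type*} [TopologicalSpace M] [ChartedSpace F M] [IsManifold 𝓘(ℝ, F) ∞ M]
  {τ : Q → ℝ} {ξ Ξ : ∀ v : TangentBundle 𝓘(ℝ, E) Q, TangentSpace 𝓘(ℝ, E).tangent v}

theorem exists_holonomicExtension [FiniteDimensional ℝ E] [T2Space Q] [SecondCountableTopology Q]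
    (hτ : IsFibreBundle (E := E) F M τ) (hξ : IsHolonomicConnection (E := E) τ ξ) :
    ∃ Ξ : ∀ v : TangentBundle 𝓘(ℝ, E) Q, TangentSpace 𝓘(ℝ, E).tangent v,
      ContMDiff 𝓘(ℝ, E).tangent 𝓘(ℝ, E).tangent.tangent ∞
        (fun v => (⟨v, Ξ v⟩ : TangentBundle 𝓘(ℝ, E).tangent (TangentBundle 𝓘(ℝ, E) Q))) ∧
      ∀ v, Ξ v ∈ holonomicExtensions (E := E) τ ξ v := by
  have : T2Space (TangentBundle 𝓘(ℝ, E) Q) := t2Space_totalSpace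
  have : SigmaCompactSpace (TangentBundle 𝓘(ℝ, E) Q) := sigmaCompactSpace_tangentBundle
  obtain ⟨Ξ, hΞ⟩ := exists_contMDiffSection_forall_mem_convex_of_local (n := ⊤)
    𝓘(ℝ, E).tangent
    (TangentSpace 𝓘(ℝ, E).tangent : TangentBundle 𝓘(ℝ, E) Q → Type _)
    (holonomicExtensions (E := E) τ ξ) (convex_holonomicExtensions τ ξ) fun v => by
      obtain ⟨χ, hq, hχ⟩ := hτ.exists_adaptedChart v.proj
      obtain ⟨Ξ, hs, hΞ⟩ := hχ.exists_local_extension hτ.smooth hτ.mem_jetOne_iff hξ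
      exact ⟨_, (χ.open_source.preimage (FiberBundle.continuous_proj E _)).mem_nhds hq, Ξ, hs, hΞ⟩
  exact ⟨Ξ, Ξ.contMDiff, hΞ⟩

/-- The condition `ẗ = 0` holds on all of `Ξ(TQ)`, so only `ṫ = 1` cuts, and it selects the points
over `J¹Q`. -/
theorem IsFibreBundle.dynamicEquation_eq_unitTimeEquation (hτ : IsFibreBundle (E := E) F M τ)
    (h0 : ∀ v, tDDot (E := E) τ ⟨v, Ξ v⟩ = 0) (hΞ : ∀ v ∈ jetOne (E := E) τ, Ξ v = ξ v) :
    dynamicEquation (E := E) τ ξ = unitTimeEquation (E := E) τ Ξ := by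
  ext w
  constructor
  · rintro ⟨v, hv, rfl⟩
    refine ⟨⟨v, congrArg (TotalSpace.mk v) (hΞ v hv)⟩, ?_, (hτ.mem_jetOne_iff v).1 hv⟩
    have h := h0 v
    rwa [hΞ v hv] at h
  · rintro ⟨⟨v, rfl⟩, -, hv⟩
    have hv' := (hτ.mem_jetOne_iff v).2 hv
    exact ⟨v, hv', congrArg (TotalSpace.mk v) (hΞ v hv').symm⟩

theorem acceleration_comp_sub (c : ℝ → Q) (a t : ℝ) :
    acceleration (E := E) (fun s => c (s - a)) t = acceleration (E := E) c (t - a) := by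
  unfold acceleration
  rw [velocity_comp_sub]
  exact congrArg (TotalSpace.mk (velocity (E := E) c (t - a)))
    (mfderiv_comp_sub (I := 𝓘(ℝ, E).tangent) (velocity (E := E) c) a t)

theorem IsSolution.comp_sub
    {S : Set (TangentBundle 𝓘(ℝ, E).tangent (TangentBundle 𝓘(ℝ, E) Q))} {J : Set ℝ} {c : ℝ → Q}
    (h : IsSolution (E := E) S J c) (a : ℝ) :
    IsSolution (E := E) S ((fun s => s + a) '' J) (fun s => c (s - a)) := by
  have ha : ContDiff ℝ ∞ fun s : ℝ => s - a := by fun_prop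
  refine ⟨h.1.comp ha.contMDiff.contMDiffOn ?_, ?_⟩
  · rintro _ ⟨s, hs, rfl⟩
    simpa using hs
  · rintro _ ⟨s, hs, rfl⟩
    rw [acceleration_comp_sub, add_sub_cancel_right]
    exact h.2 s hs

/-- The condition `ṫ = 1` gives `τ (c s) - s` derivative 0 on `J`, which is open and connected. -/
theorem IsSolution.exists_time_eq_add (hτ : ContMDiff 𝓘(ℝ, E) 𝓘(ℝ, ℝ) ∞ τ) {J : Set ℝ}
    (hJ : IsOpen J) (hJ' : J.OrdConnected) {c : ℝ → Q}
    (h : IsSolution (unitTimeEquation (E := E) τ Ξ) J c) : ∃ a, ∀ s ∈ J, τ (c s) = s + a := by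
  have hd : ∀ s ∈ J, HasDerivAt (τ ∘ c) 1 s := fun s hs => by
    have hcs := h.1.contMDiffAt (hJ.mem_nhds hs)
    have h1 : deriv (τ ∘ c) s = 1 :=
      (tDot_velocity hτ (hcs.mdifferentiableAt (by simp))).symm.trans (h.2 s hs).2.2
    rw [← h1]
    exact ((hτ.contMDiffAt.comp s hcs).mdifferentiableAt (by simp)).differentiableAt.hasDerivAt
  have hd' : ∀ s ∈ J, HasDerivAt (fun s => τ (c s) - s) 0 s := fun s hs => by
    have h1 := (hd s hs).sub (hasDerivAt_id s)
    rwa [sub_self] at h1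
  obtain ⟨a, ha⟩ := hJ.exists_is_const_of_deriv_eq_zero hJ'.isPreconnected
    (fun s hs => (hd' s hs).differentiableAt.differentiableWithinAt)
    (fun s hs => (hd' s hs).deriv)
  exact ⟨a, fun s hs => by linarith [ha s hs]⟩

end GlobalExtension

end TimeMechanics

end

theorem proposition3p1
    {E : Type*} [NormedAddCommGroup E] [NormedSpace ℝ E] [FiniteDimensional ℝ E]
    {Q : Type*} [TopologicalSpace Q] [T2Space Q] [SecondCountableTopology Q]
    [ChartedSpace E Q] [IsManifold 𝓘(ℝ, E) ∞ Q]
    {F : Type*} [NormedAddCommGroup F] [NormedSpace ℝ F] [FiniteDimensional ℝ F]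
    {M : Type*} [TopologicalSpace M] [ChartedSpace F M] [IsManifold 𝓘(ℝ, F) ∞ M]
    (τ : Q → ℝ) (hτ : TimeMechanics.IsFibreBundle (E := E) F M τ)
    (ξ : ∀ v : TangentBundle 𝓘(ℝ, E) Q, TangentSpace 𝓘(ℝ, E).tangent v)
    (hξ : TimeMechanics.IsHolonomicConnection (E := E) τ ξ) :
    ∃ Ξ : ∀ v : TangentBundle 𝓘(ℝ, E) Q, TangentSpace 𝓘(ℝ, E).tangent v,
      -- `Ξ` is a holonomic vector field on `TQ` with `Ξ⁰ = 0`
      TimeMechanics.IsHolonomicField (E := E) Ξ ∧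
      (∀ v : TangentBundle 𝓘(ℝ, E) Q, TimeMechanics.tDDot (E := E) τ ⟨v, Ξ v⟩ = 0) ∧
      -- it extends `Tλ ∘ λ₂ ∘ ξ` from `J¹Q` to `TQ`
      (∀ v ∈ TimeMechanics.jetOne (E := E) τ, Ξ v = ξ v) ∧
      -- the two equations coincide as subsets of `TTQ`
      TimeMechanics.dynamicEquation (E := E) τ ξ =
        TimeMechanics.unitTimeEquation (E := E) τ Ξ ∧
      -- the two equations have the same solutions, up to the choice of the origin of time
      (∀ J : Set ℝ, IsOpen J → J.OrdConnected → ∀ c : ℝ → Q,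
        (TimeMechanics.IsMotion (E := E) τ ξ J c ↔
          TimeMechanics.IsSolution (TimeMechanics.unitTimeEquation (E := E) τ Ξ) J c ∧
            ∀ s ∈ J, τ (c s) = s) ∧
        (TimeMechanics.IsSolution (TimeMechanics.unitTimeEquation (E := E) τ Ξ) J c →
          ∃ a : ℝ, TimeMechanics.IsMotion (E := E) τ ξ
            ((fun s => s + a) '' J) (fun s => c (s - a)))) := by
  obtain ⟨Ξ, hs, hΞ⟩ := TimeMechanics.exists_holonomicExtension hτ hξ
  have heq := hτ.dynamicEquation_eq_unitTimeEquation (fun v => (hΞ v).2.1)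
    (fun v hv => (hΞ v).2.2 hv)
  refine ⟨Ξ, ⟨hs, fun v => (hΞ v).1⟩, fun v => (hΞ v).2.1, fun v hv => (hΞ v).2.2 hv, heq,
    fun J hJ hJ' c => ⟨?_, fun h => ?_⟩⟩
  · rw [TimeMechanics.IsMotion, heq, and_comm]
  -- The offset `a` between time and parameter is exactly the translation required.
  · obtain ⟨a, ha⟩ := h.exists_time_eq_add hτ.smooth hJ hJ'
    refine ⟨a, ?_, heq ▸ h.comp_sub a⟩
    rintro _ ⟨s, hs, rfl⟩
    simp only [add_sub_cancel_right]
    exact ha s hs
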